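/- Let $d\ge 1$ and let $C_d=[-1,1]^d\subset\mathbb{R}^d$. A slice of $C_d$ is a set $Q=C_d\cap H$, where $H=\{x\in\mathbb{R}^d : \langle u,x\rangle=t\}$ with $u\neq 0$ is an affine hyperplane, such that $\dim Q=d-1$. The graph of a polytope is the abstract graph formed by its vertices and edges. Two polytopes are combinatorially equivalent if their face lattices are isomorphic. Let $Q$ be a slice of $C_d$ that contains at most two vertices of $C_d$. Then $Q$ is reconstructible from its graph: every $(d-1)$-dimensional polytope $P$ (in $\mathbb{R}^n$, for any $n$) whose graph is isomorphic to the graph of $Q$ is combinatorially equivalent to $Q$. -/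

import Mathlib

namespace CubeSlice

/-- A (convex) polytope in `ℝⁿ`: the convex hull of a finite set of points. -/
def IsPolytope {n : ℕ} (P : Set (Fin n → ℝ)) : Prop :=
  ∃ s : Set (Fin n → ℝ), s.Finite ∧ P = convexHull ℝ s

/-- `P` has (affine) dimension `k`: it is nonempty and the direction of its affine hull has
dimension `k`. (The empty set has no dimension in `ℕ`.) -/
def HasDim {n : ℕ} (P : Set (Fin n → ℝ)) (k : ℕ) : Prop :=
  P.Nonempty ∧ Module.finrank ℝ (vectorSpan ℝ P) = k

/-- The face poset of `P`, ordered by inclusion. A face is the empty set or the set of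
maximizers over `P` of a linear functional; the zero functional gives `P` itself. -/
abbrev Face {n : ℕ} (P : Set (Fin n → ℝ)) : Type :=
  {F : Set (Fin n → ℝ) // IsExposed ℝ P F}

/-- Combinatorial equivalence: the face lattices are isomorphic. -/
def CombEquiv {m n : ℕ} (P : Set (Fin m → ℝ)) (Q : Set (Fin n → ℝ)) : Prop :=
  Nonempty (Face P ≃o Face Q)

/-- The vertices of `P`: the points `v` such that `{v}` is a face. -/
def vertices {n : ℕ} (P : Set (Fin n → ℝ)) : Set (Fin n → ℝ) :=
  {v | IsExposed ℝ P {v}}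

/-- The vertex-edge graph of `P`: two distinct vertices are adjacent when the segment joining
them is a face (an edge) of `P`. -/
def graph {n : ℕ} (P : Set (Fin n → ℝ)) : SimpleGraph (vertices P) where
  Adj v w := v ≠ w ∧ IsExposed ℝ P (segment ℝ (v : Fin n → ℝ) (w : Fin n → ℝ))
  symm := ⟨fun v w h => ⟨h.1.symm, by rw [segment_symm]; exact h.2⟩⟩
  loopless := ⟨fun _ h => h.1 rfl⟩

/-- `Q` is reconstructible from its graph: every polytope of the same dimension, in a real space
of any dimension, whose graph is isomorphic to that of `Q` is combinatorially equivalent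
to `Q`. -/
def ReconstructibleFromGraph {m : ℕ} (Q : Set (Fin m → ℝ)) : Prop :=
  ∀ k : ℕ, HasDim Q k → ∀ (n : ℕ) (P : Set (Fin n → ℝ)), IsPolytope P → HasDim P k →
    Nonempty (graph P ≃g graph Q) → CombEquiv P Q

/-- The cube `[-1,1]^d`. -/
def cube (d : ℕ) : Set (Fin d → ℝ) :=
  {x | ∀ i, -1 ≤ x i ∧ x i ≤ 1}

/-- A slice of the `d`-cube: a `(d-1)`-dimensional intersection of the cube with an affine
hyperplane `{x | ⟨u, x⟩ = t}`, where `u ≠ 0`. -/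
def IsSlice (d : ℕ) (Q : Set (Fin d → ℝ)) : Prop :=
  ∃ (u : Fin d → ℝ) (t : ℝ), u ≠ 0 ∧ Q = cube d ∩ {x | u ⬝ᵥ x = t} ∧ HasDim Q (d - 1)

end CubeSlice

/-!
A polytope is replaced by its homogenization, so that faces become sets of vertices on which a
nonnegative linear functional vanishes. A vertex of a slice that is not a vertex of the cube lies in
the relative interior of an edge of the cube, and every edge at this vertex leaves exactly one of
the `d - 1` facets of the cube through it; so the vertex has degree `d - 1`, it is simple. Hence at
most two vertices `v` and `w` of the slice are not simple, and this is inherited by every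
polytope of the same dimension with the same graph.

At a simple vertex every set of neighbours spans a unique face. As in Kalai's proof for simple
polytopes, a linear functional in general position induces an ordering with a single local maximum
on each face, and counting the local maxima of faces characterizes such orderings by the graph.
Here `w` is put last, so that it is not counted, and a face `F` not containing `w` is put first. If
`v ∈ F`, then `v` is put first of all, where it is a local maximum only of the face `{v}`. This
determines the faces that contain `v` but not `w`, hence also the faces that contain neither of
them, as the local maxima at `v` can then be compared directly.

For the faces containing both `v` and `w`, agreement with a face of the other polytope propagates
from one simple vertex to the next: a two-dimensional face that spoils it would avoid `v`, so it is
already known to be common to both polytopes. It remains to see that a face stays connected when `v`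
and `w` are removed; this is clear if `v w` is an edge, and follows from Balinski's theorem in
dimension at least three. A polygon is treated by hand.
-/

namespace CubeSlice

/-! ### Faces of cones -/

section OrderedField

variable {ι K : Type*} [Finite ι] [Field K] [LinearOrder K] [IsStrictOrderedRing K]

lemma exists_pos_forall_pos_mul_add (x y : ι → K) :
    ∃ M, 0 < M ∧ ∀ i, 0 < x i → 0 < M * x i + y i := by
  obtain ⟨M, hM⟩ := (Set.finite_range fun i => (1 - y i) / x i).bddAbove
  refine ⟨max M 1, by positivity, fun i hi => ?_⟩
  have hMi : (1 - y i) / x i ≤ max M 1 := (hM ⟨i, rfl⟩).trans (le_max_left _ _)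
  rw [div_le_iff₀ hi] at hMi
  linarith

lemma exists_pos_forall_mul_add_lt (x y : ι → K) :
    ∃ M, 0 < M ∧ ∀ i j, x i < x j → M * x i + y i < M * x j + y j := by
  obtain ⟨M, hM, h⟩ := exists_pos_forall_pos_mul_add (fun a : ι × ι => x a.2 - x a.1)
    (fun a => y a.2 - y a.1)
  refine ⟨M, hM, fun i j hij => ?_⟩
  have := h (i, j) (sub_pos.2 hij)
  linarith

end OrderedField

lemma exists_dual_forall_eq {ι K W : Type*} [Field K] [AddCommGroup W] [Module K W] {x : ι → W}
    (hx : LinearIndependent K x) (c : ι → K) : ∃ g : Module.Dual K W, ∀ i, g (x i) = c i := by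
  obtain ⟨r, hr⟩ := LinearMap.exists_leftInverse_of_injective _ (LinearMap.ker_eq_bot.2 hx)
  refine ⟨Finsupp.linearCombination K c ∘ₗ r, fun i => ?_⟩
  have hri : r (x i) = Finsupp.single i 1 := by
    simpa using DFunLike.congr_fun hr (Finsupp.single i 1)
  simp [hri]

lemma finrank_span_image_le_ncard {K V W : Type*} [Field K] [AddCommGroup W] [Module K W]
    (p : V → W) {S : Set V} (hS : S.Finite) :
    Module.finrank K (Submodule.span K (p '' S)) ≤ S.ncard := by
  have := hS.fintype
  rw [Set.image_eq_range, ← Nat.card_coe_set_eq, Nat.card_eq_fintype_card]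
  exact finrank_range_le_card _

/-- The index set `A` is a face of the cone generated by the vectors `p i` if a linear functional
that is nonnegative on the cone vanishes at `p i` exactly for `i ∈ A`. -/
def IsFace (K : Type*) {V W : Type*} [Field K] [LinearOrder K] [AddCommGroup W] [Module K W]
    (p : V → W) (A : Set V) : Prop :=
  ∃ l : Module.Dual K W, (∀ i ∈ A, l (p i) = 0) ∧ ∀ i ∉ A, 0 < l (p i)

/-- The vectors `p i` span the distinct extreme rays of a pointed cone, and `G` is the graph whose
edges are the two-dimensional faces of this cone. The homogenization of a polytope is described in
this way by its vertices and its graph. -/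
structure Realizes (K : Type*) {V W : Type*} [Field K] [LinearOrder K] [AddCommGroup W]
    [Module K W] (p : V → W) (G : SimpleGraph V) : Prop where
  isFace_empty : IsFace K p ∅
  isFace_singleton (i : V) : IsFace K p {i}
  adj_iff {i j : V} : G.Adj i j ↔ i ≠ j ∧ IsFace K p {i, j}

/-- The vertex `i` is simple: its degree is one less than the dimension of the cone, which is the
dimension of a polytope whose homogenization is this cone. -/
def IsSimple (K : Type*) {V W : Type*} [Field K] [AddCommGroup W] [Module K W]
    (p : V → W) (G : SimpleGraph V) (i : V) : Prop :=
  (G.neighborSet i).ncard + 1 = Module.finrank K (Submodule.span K (Set.range p))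

section Cone

variable {K V W : Type*} [Field K] [LinearOrder K] [AddCommGroup W] [Module K W]
  {G : SimpleGraph V} {p : V → W} {A B : Set V} {i j : V}

lemma IsFace.exists_dual (hA : IsFace K p A) : ∃ l : Module.Dual K W,
    (∀ i, l (p i) = 0 ↔ i ∈ A) ∧ ∀ i ∉ A, 0 < l (p i) := by
  obtain ⟨l, hl, hl'⟩ := hA
  exact ⟨l, fun i => ⟨fun h => by_contra fun hi => (hl' i hi).ne' h, hl i⟩, hl'⟩

lemma isFace_univ : IsFace K p Set.univ := ⟨0, by simp, by simp⟩

lemma Realizes.exists_dual_singleton (h : Realizes K p G) (i : V) :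
    ∃ l : Module.Dual K W, l (p i) = 0 ∧ ∀ j ≠ i, 0 < l (p j) := by
  obtain ⟨l, hl, hl'⟩ := h.isFace_singleton i
  exact ⟨l, hl i rfl, hl'⟩

/-- The sets `A` and `B` contain `x` and the same neighbours of `x`. -/
structure AgreeAt (G : SimpleGraph V) (A B : Set V) (x : V) : Prop where
  mem_left : x ∈ A
  mem_right : x ∈ B
  inter_eq : G.neighborSet x ∩ A = G.neighborSet x ∩ B

lemma AgreeAt.symm {x : V} (h : AgreeAt G A B x) : AgreeAt G B A x :=
  ⟨h.mem_right, h.mem_left, h.inter_eq.symm⟩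

lemma AgreeAt.mem_iff {x y : V} (h : AgreeAt G A B x) (hxy : G.Adj x y) : y ∈ A ↔ y ∈ B := by
  have : y ∈ G.neighborSet x := hxy
  simpa [this] using Set.ext_iff.1 h.inter_eq y

variable [IsStrictOrderedRing K]

lemma Realizes.exists_dual_neg_pos (h : Realizes K p G) {z : V} (hij : i ≠ j) (hiz : i ≠ z)
    (hjz : j ≠ z) : ∃ m : Module.Dual K W, m (p i) = 0 ∧ m (p j) < 0 ∧ 0 < m (p z) := by
  obtain ⟨l, hlj, hl⟩ := h.exists_dual_singleton j
  obtain ⟨l', hlz', hl'⟩ := h.exists_dual_singleton z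
  refine ⟨l' (p i) • l - l (p i) • l', by simp [mul_comm], ?_, ?_⟩
  · simpa [hlj] using mul_pos (hl i hij) (hl' j hjz)
  · simpa [hlz'] using mul_pos (hl' i hiz) (hl z hjz.symm)

variable [Finite V]

lemma IsFace.sep (hA : IsFace K p A) {m : Module.Dual K W} (hm : ∀ i ∈ A, 0 ≤ m (p i)) :
    IsFace K p {i ∈ A | m (p i) = 0} := by
  obtain ⟨l, hl, hl'⟩ := hA
  obtain ⟨M, -, hM⟩ := exists_pos_forall_pos_mul_add (fun i => l (p i)) (fun i => m (p i))
  refine ⟨M • l + m, fun i hi => by simp [hl i hi.1, hi.2], fun i hi => ?_⟩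
  by_cases hiA : i ∈ A
  · simpa [hl i hiA] using (hm i hiA).lt_of_ne fun h0 => hi ⟨hiA, h0.symm⟩
  · simpa using hM i (hl' i hiA)

lemma IsFace.inter (hA : IsFace K p A) (hB : IsFace K p B) : IsFace K p (A ∩ B) := by
  obtain ⟨l, hl, hl'⟩ := hB.exists_dual
  simpa only [hl] using! hA.sep (m := l) fun i _ => by
    by_cases hi : i ∈ B
    exacts [((hl i).2 hi).ge, (hl' i hi).le]

lemma exists_forall_mul_le {x y : V → K} (hx : ∀ j ≠ i, 0 < x j) (hxi : x i = 0) (hyi : y i = 0)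
    (hA : ∃ j ∈ A, j ≠ i) :
    ∃ c, (∀ j ∈ A, c * x j ≤ y j) ∧ ∃ j ∈ A, j ≠ i ∧ y j = c * x j := by
  obtain ⟨j, ⟨hjA, hji⟩, hmin⟩ := Set.exists_min_image {j ∈ A | j ≠ i} (fun j => y j / x j)
    (Set.toFinite _) hA
  refine ⟨y j / x j, fun k hk => ?_, j, hjA, hji, (div_mul_cancel₀ _ (hx j hji).ne').symm⟩
  rcases eq_or_ne k i with rfl | hki
  · simp [hxi, hyi]
  · exact (le_div_iff₀ (hx k hki)).1 (hmin k ⟨hk, hki⟩)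

-- The smallest ratio of `m` to a functional vanishing only at `i` cuts out a face through `i`.
lemma Realizes.exists_isFace_le (h : Realizes K p G) (hA : IsFace K p A) (hi : i ∈ A)
    (hne : ∃ j ∈ A, j ≠ i) {m : Module.Dual K W} (hmi : m (p i) = 0) :
    ∃ l : Module.Dual K W, (∀ j ≠ i, 0 < l (p j)) ∧ ∃ (c : K) (B : Set V), IsFace K p B ∧ B ⊆ A ∧
      i ∈ B ∧ (∃ j ∈ B, j ≠ i) ∧ (∀ j ∈ B, m (p j) = c * l (p j)) ∧
      ∀ j ∈ A, c * l (p j) ≤ m (p j) := by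
  obtain ⟨l, hli, hl⟩ := h.exists_dual_singleton i
  obtain ⟨c, hle, y, hyA, hyi, hy⟩ := exists_forall_mul_le (x := fun j => l (p j))
    (y := fun j => m (p j)) hl hli hmi hne
  exact ⟨l, hl, c, _, hA.sep (m := m - c • l) fun j hj => by simpa using hle j hj,
    Set.sep_subset _ _, ⟨hi, by simp [hli, hmi]⟩, ⟨y, ⟨hyA, by simp [hy]⟩, hyi⟩,
    fun j hj => by simpa [sub_eq_zero] using hj.2, hle⟩

lemma Realizes.exists_adj (h : Realizes K p G) (hA : IsFace K p A) (hi : i ∈ A)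
    (hne : ∃ j ∈ A, j ≠ i) : ∃ y ∈ A, G.Adj i y := by
  induction A using WellFoundedLT.induction with
  | ind A ih =>
  obtain ⟨j, hj, hji⟩ := hne
  by_cases hsub : A ⊆ {i, j}
  · have hA2 : A = {i, j} := hsub.antisymm (Set.pair_subset hi hj)
    exact ⟨j, hj, h.adj_iff.2 ⟨hji.symm, hA2 ▸ hA⟩⟩
  obtain ⟨z, hz, hzij⟩ := Set.not_subset.1 hsub
  obtain ⟨hzi, hzj⟩ : z ≠ i ∧ z ≠ j := by simpa using hzij
  obtain ⟨m, hmi, hmj, hmz⟩ := h.exists_dual_neg_pos hji.symm hzi.symm hzj.symm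
  obtain ⟨l, hl, c, B, hB, hBA, hiB, hneB, hmem, -⟩ := h.exists_isFace_le hA hi ⟨j, hj, hji⟩ hmi
  have hne : B ≠ A := by
    rintro rfl
    have hc_neg : c < 0 := neg_of_mul_neg_left (hmem j hj ▸ hmj) (hl j hji).le
    have hc_pos : 0 < c := pos_of_mul_pos_left (hmem z hz ▸ hmz) (hl z hzi).le
    exact hc_neg.not_gt hc_pos
  obtain ⟨y, hy, hadj⟩ := ih B (hBA.ssubset_of_ne hne) hB hiB hneB
  exact ⟨y, hBA hy, hadj⟩

lemma Realizes.nonneg_of_adj (h : Realizes K p G) (hA : IsFace K p A) (hi : i ∈ A)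
    {g : Module.Dual K W} (hgi : g (p i) = 0) (hg : ∀ y ∈ A, G.Adj i y → 0 ≤ g (p y)) :
    ∀ j ∈ A, 0 ≤ g (p j) := by
  intro j hj
  rcases eq_or_ne j i with rfl | hji
  · exact hgi.ge
  obtain ⟨l, hl, c, B, hB, hBA, hiB, hneB, hmem, hle⟩ := h.exists_isFace_le hA hi ⟨j, hj, hji⟩ hgi
  obtain ⟨y, hy, hadj⟩ := h.exists_adj hB hiB hneB
  have hc : 0 ≤ c :=
    nonneg_of_mul_nonneg_left (hmem y hy ▸ hg y (hBA hy) hadj) (hl y hadj.ne')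
  exact (mul_nonneg hc (hl j hji).le).trans (hle j hj)

lemma Realizes.eq_zero_of_adj (h : Realizes K p G) (hA : IsFace K p A) (hi : i ∈ A)
    {g : Module.Dual K W} (hgi : g (p i) = 0) (hg : ∀ y ∈ A, G.Adj i y → g (p y) = 0) :
    ∀ j ∈ A, g (p j) = 0 := by
  intro j hj
  have hneg : 0 ≤ (-g) (p j) := h.nonneg_of_adj hA hi (by simp [hgi])
    (fun y hy hadj => by simp [hg y hy hadj]) j hj
  exact le_antisymm (neg_nonneg.1 hneg)
    (h.nonneg_of_adj hA hi hgi (fun y hy hadj => (hg y hy hadj).ge) j hj)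

lemma Realizes.subset_of_adj (h : Realizes K p G) (hA : IsFace K p A) (hB : IsFace K p B)
    (hiA : i ∈ A) (hiB : i ∈ B) (hAB : G.neighborSet i ∩ A ⊆ B) : A ⊆ B := by
  obtain ⟨l, hl, -⟩ := hB.exists_dual
  exact fun j hj => (hl j).1 <| h.eq_zero_of_adj hA hiA ((hl i).2 hiB)
    (fun y hy hadj => (hl y).2 (hAB ⟨hadj, hy⟩)) j hj

lemma Realizes.span_image_insert_neighborSet (h : Realizes K p G) (hA : IsFace K p A)
    (hi : i ∈ A) : Submodule.span K (p '' insert i (G.neighborSet i ∩ A)) =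
      Submodule.span K (p '' A) := by
  apply le_antisymm
  · exact Submodule.span_mono
      (Set.image_mono (Set.insert_subset hi Set.inter_subset_right))
  · rw [Submodule.span_le]
    rintro _ ⟨j, hj, rfl⟩
    by_contra hnot
    obtain ⟨m, hm, hker⟩ := Submodule.exists_le_ker_of_notMem hnot
    have hzero : ∀ y ∈ insert i (G.neighborSet i ∩ A), m (p y) = 0 := fun y hy =>
      hker (Submodule.subset_span ⟨y, hy, rfl⟩)
    exact hm (h.eq_zero_of_adj hA hi (hzero i (Set.mem_insert _ _))
      (fun y hy hadj => hzero y (Or.inr ⟨hadj, hy⟩)) j hj)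

lemma Realizes.eq_of_agreeAt (h : Realizes K p G) (hA : IsFace K p A) (hB : IsFace K p B)
    (hAB : AgreeAt G A B i) : A = B :=
  (h.subset_of_adj hA hB hAB.mem_left hAB.mem_right fun _ hy => (hAB.inter_eq ▸ hy).2).antisymm
    (h.subset_of_adj hB hA hAB.mem_right hAB.mem_left fun _ hy => (hAB.inter_eq ▸ hy).2)

lemma ncard_insert_neighborSet_inter : (insert i (G.neighborSet i ∩ A)).ncard =
    (G.neighborSet i ∩ A).ncard + 1 :=
  Set.ncard_insert_of_notMem (by simp) (Set.toFinite _)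

lemma ncard_insert_neighborSet :
    (insert i (G.neighborSet i)).ncard = (G.neighborSet i).ncard + 1 := by
  simpa using ncard_insert_neighborSet_inter (G := G) (i := i) (A := Set.univ)

lemma Realizes.span_image_insert_neighborSet_univ (h : Realizes K p G) (i : V) :
    Submodule.span K (p '' insert i (G.neighborSet i)) = Submodule.span K (Set.range p) := by
  simpa only [Set.inter_univ, Set.image_univ] using
    h.span_image_insert_neighborSet isFace_univ (Set.mem_univ i)

lemma Realizes.finrank_span_le_ncard_neighborSet_add_one (h : Realizes K p G) (i : V) :
    Module.finrank K (Submodule.span K (Set.range p)) ≤ (G.neighborSet i).ncard + 1 := by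
  rw [← h.span_image_insert_neighborSet_univ i, ← ncard_insert_neighborSet]
  exact finrank_span_image_le_ncard p (Set.toFinite _)

lemma Realizes.linearIndepOn (h : Realizes K p G) (hs : IsSimple K p G i) :
    LinearIndepOn K p (insert i (G.neighborSet i)) := by
  have := Fintype.ofFinite (insert i (G.neighborSet i) : Set V)
  refine linearIndependent_iff_card_eq_finrank_span.2 ?_
  rw [← Nat.card_eq_fintype_card, Nat.card_coe_set_eq, ncard_insert_neighborSet, hs,
    Set.finrank, ← Set.image_eq_range, h.span_image_insert_neighborSet_univ]

lemma Realizes.ncard_neighborSet_inter (h : Realizes K p G) (hs : IsSimple K p G i)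
    (hA : IsFace K p A) (hi : i ∈ A) :
    (G.neighborSet i ∩ A).ncard + 1 = Module.finrank K (Submodule.span K (p '' A)) := by
  have := Fintype.ofFinite (insert i (G.neighborSet i ∩ A) : Set V)
  have hli : LinearIndepOn K p (insert i (G.neighborSet i ∩ A)) :=
    (h.linearIndepOn hs).mono (Set.insert_subset_insert Set.inter_subset_left)
  rw [← h.span_image_insert_neighborSet hA hi, Set.image_eq_range, finrank_span_eq_card hli,
    ← ncard_insert_neighborSet_inter, ← Nat.card_coe_set_eq, Nat.card_eq_fintype_card]

lemma Realizes.exists_isFace_agreeAt (h : Realizes K p G) (hs : IsSimple K p G i) (hi : i ∈ A) :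
    ∃ B, IsFace K p B ∧ AgreeAt G A B i := by
  classical
  obtain ⟨g, hg⟩ := exists_dual_forall_eq (h.linearIndepOn hs) fun y => Set.indicator Aᶜ 1 y.1
  have hgi : g (p i) = 0 := by simp [hg ⟨i, Set.mem_insert _ _⟩, hi]
  have hnn : ∀ y, G.Adj i y → 0 ≤ g (p y) := fun y hy => by
    rw [hg ⟨y, Or.inr hy⟩]
    exact Set.indicator_nonneg (fun _ _ => zero_le_one) y
  refine ⟨_, isFace_univ.sep (h.nonneg_of_adj isFace_univ (Set.mem_univ i) hgi fun y _ => hnn y),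
    hi, by simpa using hgi, ?_⟩
  ext y
  simp only [Set.mem_inter_iff, SimpleGraph.mem_neighborSet, Set.mem_ofPred_eq, Set.mem_univ,
    true_and, and_congr_right_iff]
  intro hy
  simp [hg ⟨y, Or.inr hy⟩, Set.indicator_apply]

lemma Realizes.exists_isFace_inter_eq_pair (h : Realizes K p G) (hs : IsSimple K p G i)
    (hA : IsFace K p A) (hi : i ∈ A) {x a : V} (hx : x ∈ A) (hix : G.Adj i x) (ha : a ∉ A)
    (hia : G.Adj i a) :
    ∃ T, IsFace K p T ∧ i ∈ T ∧ G.neighborSet i ∩ T = {x, a} ∧ T ∩ A = {i, x} := by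
  obtain ⟨T, hT, -, hT', hTeq⟩ := h.exists_isFace_agreeAt hs (A := {i, x, a}) (by simp)
  replace hTeq : G.neighborSet i ∩ T = {x, a} := by
    rw [← hTeq, Set.inter_insert_of_notMem (by simp), Set.inter_eq_right]
    exact Set.pair_subset hix hia
  have hmem (y : V) (hy : G.Adj i y) : y ∈ T ↔ y = x ∨ y = a := by
    simpa [hy] using Set.ext_iff.1 hTeq y
  refine ⟨T, hT, hT', hTeq,
    h.eq_of_agreeAt (hT.inter hA) (h.adj_iff.1 hix).2 (i := i) ⟨⟨hT', hi⟩, by simp, ?_⟩⟩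
  ext y
  simp only [Set.mem_inter_iff, SimpleGraph.mem_neighborSet, Set.mem_insert_iff,
    Set.mem_singleton_iff, and_congr_right_iff]
  intro hy
  rw [hmem y hy, or_iff_right hy.ne']
  exact ⟨fun ⟨hxa, hyA⟩ => hxa.resolve_right (ne_of_mem_of_not_mem hyA ha),
    fun hyx => ⟨.inl hyx, hyx ▸ hx⟩⟩

lemma Realizes.subset_of_finrank_le_three (h : Realizes K p G) {v w : V}
    (hs : ∀ y ∉ ({v, w} : Set V), IsSimple K p G y) (hA : IsFace K p A) (hB : IsFace K p B)
    (hvwA : {v, w} ⊆ A) (hvwB : {v, w} ⊆ B) (hvw : v ≠ w) (hadj : ¬ G.Adj v w)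
    (hr : Module.finrank K (Submodule.span K (p '' A)) ≤ 3) : A ⊆ B := by
  have hAB := hA.inter hB
  obtain ⟨hv, hw⟩ := Set.pair_subset_iff.1 (Set.subset_inter hvwA hvwB)
  obtain ⟨y, hy, hvy⟩ := h.exists_adj hAB hv ⟨w, hw, hvw.symm⟩
  have hyw : y ≠ w := fun hyw => hadj (hyw ▸ hvy)
  have hcardA := h.ncard_neighborSet_inter (hs y (by simp [hvy.ne', hyw])) hA hy.1
  have hcardAB : 1 < (G.neighborSet y ∩ (A ∩ B)).ncard := by
    by_contra! hle
    have hsub : A ∩ B ⊆ {v, y} := h.subset_of_adj hAB (h.adj_iff.1 hvy).2 hy (by simp)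
      fun z hz => Or.inl <| Set.ncard_le_one_iff_subsingleton.1 hle hz ⟨hvy.symm, hv⟩
    exact (hsub hw).elim hvw.symm hyw.symm
  have heq : G.neighborSet y ∩ (A ∩ B) = G.neighborSet y ∩ A :=
    Set.eq_of_subset_of_ncard_le (by gcongr; exact Set.inter_subset_left) (by omega)
  exact h.subset_of_adj hA hB hy.1 hy.2 (heq ▸ Set.inter_subset_right.trans Set.inter_subset_right)

lemma Realizes.div_le_div_of_adj (h : Realizes K p G) (hA : IsFace K p A) (hi : i ∈ A)
    {a b : Module.Dual K W} (hb : ∀ j, 0 < b (p j))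
    (hmax : ∀ y ∈ A, G.Adj i y → a (p y) / b (p y) ≤ a (p i) / b (p i)) :
    ∀ y ∈ A, a (p y) / b (p y) ≤ a (p i) / b (p i) := by
  have key (y : V) : a (p y) / b (p y) ≤ a (p i) / b (p i) ↔
      0 ≤ ((a (p i) / b (p i)) • b - a) (p y) := by simp [div_le_iff₀ (hb y)]
  have hzero : ((a (p i) / b (p i)) • b - a) (p i) = 0 := by simp [(hb i).ne']
  exact fun y hy => (key y).2 <|
    h.nonneg_of_adj hA hi hzero (fun z hz hadj => (key z).1 (hmax z hz hadj)) y hy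

lemma exists_dual_lex (p : V → W) (a g b : Module.Dual K W) : ∃ a' : Module.Dual K W,
    (∀ i j, a (p i) / b (p i) < a (p j) / b (p j) →
      a' (p i) / b (p i) < a' (p j) / b (p j)) ∧
    ∀ i j, a (p i) / b (p i) = a (p j) / b (p j) → g (p i) / b (p i) < g (p j) / b (p j) →
      a' (p i) / b (p i) < a' (p j) / b (p j) := by
  obtain ⟨M, -, hM⟩ := exists_pos_forall_mul_add_lt (fun i => a (p i) / b (p i))
    (fun i => g (p i) / b (p i))
  have hval (i : V) : (M • a + g) (p i) / b (p i) =
      M * (a (p i) / b (p i)) + g (p i) / b (p i) := by simp [add_div, mul_div_assoc]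
  simp only [← hval] at hM
  refine ⟨M • a + g, hM, fun i j haij hgij => ?_⟩
  rw [hval, hval, haij]
  exact add_lt_add_right hgij _

lemma Realizes.exists_dual_injective (h : Realizes K p G) {b : Module.Dual K W}
    (hb : ∀ i, 0 < b (p i)) :
    ∃ g : Module.Dual K W, Function.Injective fun i => g (p i) / b (p i) := by
  have hne (x : {x : V × V // x.1 ≠ x.2}) : b (p x.1.2) • p x.1.1 - b (p x.1.1) • p x.1.2 ≠ 0 := by
    obtain ⟨⟨i, j⟩, hij⟩ := x
    obtain ⟨l, hli, hl⟩ := h.exists_dual_singleton i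
    intro h0
    simpa [hli, (hb i).ne', (hl j (Ne.symm hij)).ne'] using congrArg l h0
  obtain ⟨g, hg⟩ := Module.exists_dual_forall_apply_ne_zero (K := K) _ hne
  refine ⟨g, fun i j hij => by_contra fun hne => hg ⟨⟨i, j⟩, hne⟩ ?_⟩
  rw [div_eq_div_iff (hb i).ne' (hb j).ne'] at hij
  simp only [map_sub, map_smul, smul_eq_mul]
  linarith

lemma Realizes.exists_dual_refinement (h : Realizes K p G) {b : Module.Dual K W}
    (hb : ∀ i, 0 < b (p i)) (a : Module.Dual K W) :
    ∃ a' : Module.Dual K W, (Function.Injective fun i => a' (p i) / b (p i)) ∧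
      ∀ i j, a (p i) / b (p i) < a (p j) / b (p j) → a' (p i) / b (p i) < a' (p j) / b (p j) := by
  obtain ⟨g, hg⟩ := h.exists_dual_injective hb
  obtain ⟨a', ha', hga'⟩ := exists_dual_lex p a g b
  refine ⟨a', fun i j hij => by_contra fun hne => ?_, ha'⟩
  rcases lt_trichotomy (a (p i) / b (p i)) (a (p j) / b (p j)) with hlt | heq | hgt
  · exact (ha' i j hlt).ne hij
  · rcases lt_or_gt_of_ne (hg.ne hne) with hlt | hgt
    · exact (hga' i j heq hlt).ne hij
    · exact (hga' j i heq.symm hgt).ne' hij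
  · exact (ha' j i hgt).ne' hij

lemma Realizes.exists_dual_pos_forall_div_lt (h : Realizes K p G) {l : Module.Dual K W}
    (hi : 0 < l (p i)) : ∃ b : Module.Dual K W, (∀ j, 0 < b (p j)) ∧
      ∀ j ≠ i, l (p j) / b (p j) < l (p i) / b (p i) := by
  obtain ⟨e, -, he⟩ := h.isFace_empty
  obtain ⟨m, hmi, hm⟩ := h.exists_dual_singleton i
  obtain ⟨M, hM, hMlt⟩ := exists_pos_forall_pos_mul_add (fun j => l (p i) * m (p j))
    (fun j => l (p i) * e (p j) - l (p j) * e (p i))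
  have hb : ∀ j, 0 < (M • m + e) (p j) := by
    intro j
    rcases eq_or_ne j i with rfl | hji
    · simpa [hmi] using he j (Set.notMem_empty j)
    · simpa using add_pos (mul_pos hM (hm j hji)) (he j (Set.notMem_empty j))
  refine ⟨M • m + e, hb, fun j hji => ?_⟩
  rw [div_lt_div_iff₀ (hb j) (hb i)]
  have := hMlt j (mul_pos hi (hm j hji))
  simp only [LinearMap.add_apply, LinearMap.smul_apply, hmi, smul_eq_mul]
  linarith

/-! ### Good orderings -/

/-- The vertex `x` is a local maximum of `f` on the graph induced on `A`. -/
def IsPeak {α : Type*} [LE α] (G : SimpleGraph V) (f : V → α) (A : Set V) (x : V) : Prop :=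
  x ∈ A ∧ ∀ y ∈ A, G.Adj x y → f y ≤ f x

/-- The values of `f` order the vertices in such a way that every face has a single local
maximum. These are the good orderings in Kalai's reconstruction of simple polytopes. -/
structure IsGood (K : Type*) {V W α : Type*} [Field K] [LinearOrder K] [AddCommGroup W]
    [Module K W] [LE α] (p : V → W) (G : SimpleGraph V) (f : V → α) : Prop where
  injective : Function.Injective f
  le_of_isPeak {A : Set V} {x : V} : IsFace K p A → IsPeak G f A x → ∀ y ∈ A, f y ≤ f x

lemma Realizes.exists_isGood (h : Realizes K p G) {F : Set V} (hF : IsFace K p F) (v : V) {w : V}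
    (hw : w ∉ F) : ∃ f : V → K, IsGood K p G f ∧ (∀ x ∈ F, ∀ y ∉ F, f x < f y) ∧
      (∀ x ≠ w, f x < f w) ∧ (v ∈ F → ∀ x ≠ v, f v < f x) := by
  obtain ⟨l, hlF, hl⟩ := hF
  obtain ⟨n, hnv, hn⟩ := h.exists_dual_singleton v
  obtain ⟨b, hb, hbw⟩ := h.exists_dual_pos_forall_div_lt (hl w hw)
  obtain ⟨a₁, hla₁, hna₁⟩ := exists_dual_lex p l n b
  obtain ⟨a, hinj, ha⟩ := h.exists_dual_refinement hb a₁
  have hinit : ∀ x ∈ F, ∀ y ∉ F, a (p x) / b (p x) < a (p y) / b (p y) := fun x hx y hy =>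
    ha x y <| hla₁ x y <| by simpa [hlF x hx] using div_pos (hl y hy) (hb y)
  refine ⟨fun i => a (p i) / b (p i),
    ⟨hinj, fun hA hx => h.div_le_div_of_adj hA hx.1 hb hx.2⟩, hinit,
    fun x hx => ha x w (hla₁ x w (hbw x hx)), fun hv x hxv => ?_⟩
  by_cases hx : x ∈ F
  · exact ha v x <| hna₁ v x (by simp [hlF v hv, hlF x hx]) <| by
      simpa [hnv] using div_pos (hn x hxv) (hb x)
  · exact hinit v hv x hx

lemma Realizes.exists_adj_pos (h : Realizes K p G) (hA : IsFace K p A) (hi : i ∈ A)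
    {g : Module.Dual K W} (hgi : g (p i) = 0) (hpos : ∃ z ∈ A, 0 < g (p z)) :
    ∃ y ∈ A, G.Adj i y ∧ 0 < g (p y) := by
  obtain ⟨z, hz, hgz⟩ := hpos
  by_contra! hle
  have := h.nonneg_of_adj hA hi (g := -g) (by simp [hgi])
    (fun y hy hadj => by simpa using hle y hy hadj) z hz
  exact hgz.not_ge (by simpa using this)

lemma Realizes.exists_reachable (h : Realizes K p G) (hA : IsFace K p A) {S : Set V}
    {g : Module.Dual K W} (hS : ∀ x ∈ S, g (p x) ≤ 0) (hpos : ∃ z ∈ A, 0 < g (p z)) :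
    ∃ s : ↥(A \ S), ∀ x : ↥(A \ S), 0 ≤ g (p x) → (G.induce (A \ S)).Reachable x s := by
  obtain ⟨e, -, he⟩ := h.isFace_empty
  replace he (i : V) : 0 < e (p i) := he i (Set.notMem_empty i)
  obtain ⟨a, hinj, ha⟩ := h.exists_dual_refinement he g
  have ha_pos {x y : V} (hx : g (p x) ≤ 0) (hy : 0 < g (p y)) :
      a (p x) / e (p x) < a (p y) / e (p y) :=
    ha x y ((div_nonpos_of_nonpos_of_nonneg hx (he x).le).trans_lt (div_pos hy (he y)))
  have hnotMem {x : V} (hx : 0 < g (p x)) : x ∉ S := fun hxS => (hS x hxS).not_gt hx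
  obtain ⟨z, hz, hgz⟩ := hpos
  obtain ⟨s, hsA, hmax⟩ := Set.exists_max_image A (fun i => a (p i) / e (p i)) A.toFinite ⟨z, hz⟩
  have hgs : 0 < g (p s) := lt_of_not_ge fun hgs => (ha_pos hgs hgz).not_ge (hmax z hz)
  refine ⟨⟨s, hsA, hnotMem hgs⟩, fun x hgx => ?_⟩
  -- The largest vertex that can be reached from `x` is a local maximum, hence it is `s`.
  obtain ⟨y, ⟨hgy, hxy⟩, hymax⟩ := Set.exists_max_image
    {y : ↥(A \ S) | 0 ≤ g (p y) ∧ (G.induce (A \ S)).Reachable x y}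
    (fun y => a (p y) / e (p y)) (Set.toFinite _) ⟨x, hgx, .rfl⟩
  have hup : ∀ t ∈ A, G.Adj y t → 0 < g (p t) → a (p t) / e (p t) ≤ a (p y) / e (p y) :=
    fun t ht hadj hgt => hymax ⟨t, ht, hnotMem hgt⟩
      ⟨hgt.le, hxy.trans (SimpleGraph.Adj.reachable (G := G.induce (A \ S)) hadj)⟩
  have hgy_pos : 0 < g (p y) := by
    refine hgy.lt_of_ne fun h0 => ?_
    obtain ⟨t, ht, hadj, hgt⟩ := h.exists_adj_pos hA y.2.1 h0.symm ⟨z, hz, hgz⟩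
    exact (ha_pos h0.ge hgt).not_ge (hup t ht hadj hgt)
  have hsy : a (p s) / e (p s) ≤ a (p y) / e (p y) := by
    refine h.div_le_div_of_adj hA y.2.1 he (fun t ht hadj => ?_) s hsA
    rcases lt_or_ge 0 (g (p t)) with hgt | hgt
    exacts [hup t ht hadj hgt, (ha_pos hgt hgy_pos).le]
  have hys : y = ⟨s, hsA, hnotMem hgs⟩ := Subtype.ext (hinj (le_antisymm (hmax y y.2.1) hsy))
  exact hys ▸ hxy

lemma Realizes.preconnected_induce_sdiff_of_isFace (h : Realizes K p G) (hA : IsFace K p A)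
    (hB : IsFace K p B) : (G.induce (A \ B)).Preconnected := by
  intro x y
  obtain ⟨g, hg, hg'⟩ := hB
  obtain ⟨s, hs⟩ := h.exists_reachable hA (fun z hz => (hg z hz).le) ⟨x, x.2.1, hg' x x.2.2⟩
  exact (hs x (hg' x x.2.2).le).trans (hs y (hg' y y.2.2).le).symm

lemma exists_dual_pos_of_ncard_lt {S : Set V}
    (hS : S.ncard < Module.finrank K (Submodule.span K (p '' A))) :
    ∃ g : Module.Dual K W, (∀ i ∈ S, g (p i) = 0) ∧ ∃ z ∈ A, 0 < g (p z) := by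
  obtain ⟨z, hz, hnot⟩ : ∃ z ∈ A, p z ∉ Submodule.span K (p '' S) := by
    by_contra! hcon
    have hle : Submodule.span K (p '' A) ≤ Submodule.span K (p '' S) :=
      Submodule.span_le.2 (Set.image_subset_iff.2 hcon)
    have := FiniteDimensional.span_of_finite K (S.toFinite.image p)
    exact hS.not_ge ((Submodule.finrank_mono hle).trans (finrank_span_image_le_ncard p S.toFinite))
  obtain ⟨m, hm, hker⟩ := Submodule.exists_le_ker_of_notMem hnot
  have hm0 (i : V) (hi : i ∈ S) : m (p i) = 0 := hker (Submodule.subset_span ⟨i, hi, rfl⟩)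
  rcases lt_or_gt_of_ne hm with hlt | hgt
  · exact ⟨-m, fun i hi => by simp [hm0 i hi], z, hz, by simpa using hlt⟩
  · exact ⟨m, hm0, z, hz, hgt⟩

-- Balinski's theorem: the graph of a polytope of dimension `d` is `d`-connected.
lemma Realizes.preconnected_induce_sdiff (h : Realizes K p G) (hA : IsFace K p A) {S : Set V}
    (hS : S.ncard + 1 < Module.finrank K (Submodule.span K (p '' A))) :
    (G.induce (A \ S)).Preconnected := by
  intro x y
  obtain ⟨g, hg, hpos⟩ := exists_dual_pos_of_ncard_lt
    ((Set.ncard_insert_le (x : V) S).trans_lt hS)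
  have hgx : g (p x) = 0 := hg x (Set.mem_insert _ _)
  have hgS (z : V) (hz : z ∈ S) : g (p z) = 0 := hg z (Set.mem_insert_of_mem _ hz)
  rcases le_or_gt 0 (g (p y)) with hgy | hgy
  · obtain ⟨s, hs⟩ := h.exists_reachable hA (fun z hz => (hgS z hz).le) hpos
    exact (hs x hgx.ge).trans (hs y hgy).symm
  · have hneg : 0 < (-g) (p y) := by simpa using hgy
    obtain ⟨s, hs⟩ := h.exists_reachable hA (g := -g) (fun z hz => by simp [hgS z hz])
      ⟨y, y.2.1, hneg⟩
    exact (hs x (by simp [hgx])).trans (hs y hneg.le).symm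

end Cone

section Graph

variable {V : Type*} {G : SimpleGraph V} {S : Set V} {C : V → Prop} {x y : V}

lemma of_preconnected_induce (hS : (G.induce S).Preconnected)
    (hC : ∀ x ∈ S, ∀ y ∈ S, G.Adj x y → C x → C y) (hx : x ∈ S) (hCx : C x) (hy : y ∈ S) :
    C y := by
  have key (z : S) (hz : Relation.ReflTransGen (G.induce S).Adj ⟨x, hx⟩ z) : C z := by
    induction hz with
    | refl => exact hCx
    | tail _ hab hCa => exact hC _ (Subtype.prop _) _ (Subtype.prop _) hab hCa
  exact key ⟨y, hy⟩ ((SimpleGraph.reachable_iff_reflTransGen _ _).1 (hS _ _))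

end Graph

section Counting

variable {K V W α : Type*} [Field K] [LinearOrder K] [AddCommGroup W] [Module K W] [LinearOrder α]
  {G : SimpleGraph V} {p : V → W} {f : V → α} {v w x : V} {A B : Set V}

lemma IsPeak.of_agreeAt (hA : IsPeak G f A x) (hAB : AgreeAt G A B x) : IsPeak G f B x :=
  ⟨hAB.mem_right, fun y hy hxy => hA.2 y ((hAB.mem_iff hxy).2 hy) hxy⟩

/-- The nonempty faces that do not contain `w`. -/
def facesOff (K : Type*) {V W : Type*} [Field K] [LinearOrder K] [AddCommGroup W] [Module K W]
    (p : V → W) (w : V) : Set (Set V) :=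
  {A | IsFace K p A ∧ A.Nonempty ∧ w ∉ A}

/-- The pairs of a face and a local maximum `x` of `f` on it, where `x` is not `w` and faces that
contain `w` do not count for `x = v`. Hence only faces that avoid `w` or that are seen from a vertex
other than `v` and `w` are counted. -/
def peaks (K : Type*) {V W α : Type*} [Field K] [LinearOrder K] [AddCommGroup W] [Module K W]
    [LE α] (p : V → W) (G : SimpleGraph V) (f : V → α) (v w : V) : Set (V × Set V) :=
  {a | IsFace K p a.2 ∧ IsPeak G f a.2 a.1 ∧ a.1 ≠ w ∧ (a.1 = v → w ∉ a.2)}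

variable [Finite V]

lemma facesOff_subset_image_snd (p : V → W) (G : SimpleGraph V) (f : V → α) (v w : V) :
    facesOff K p w ⊆ Prod.snd '' {a ∈ peaks K p G f v w | w ∉ a.2 ∧ ∀ y ∈ a.2, f y ≤ f a.1} := by
  rintro A ⟨hA, hne, hw⟩
  obtain ⟨x, hx, hmax⟩ := Set.exists_max_image A f A.toFinite hne
  exact ⟨(x, A), ⟨⟨hA, ⟨hx, fun y hy _ => hmax y hy⟩, fun hxw => hw (hxw ▸ hx), fun _ => hw⟩,
    hw, hmax⟩, rfl⟩

lemma ncard_facesOff_le_ncard_peaks (p : V → W) (G : SimpleGraph V) (f : V → α) (v w : V) :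
    (facesOff K p w).ncard ≤ (peaks K p G f v w).ncard :=
  (Set.ncard_le_ncard ((facesOff_subset_image_snd p G f v w).trans
    (Set.image_mono (Set.sep_subset _ _)))).trans (Set.ncard_image_le (Set.toFinite _))

lemma IsGood.ncard_peaks_le_ncard_facesOff (hf : IsGood K p G f) (hw : ∀ x ≠ w, f x < f w)
    (v : V) : (peaks K p G f v w).ncard ≤ (facesOff K p w).ncard := by
  refine Set.ncard_le_ncard_of_injOn Prod.snd ?_ ?_
  · rintro ⟨x, A⟩ ⟨hA, hx, hxw, -⟩
    exact ⟨hA, ⟨x, hx.1⟩, fun hwA => (hw x hxw).not_ge (hf.le_of_isPeak hA hx w hwA)⟩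
  · rintro ⟨x, A⟩ ⟨hA, hx, -⟩ ⟨y, B⟩ ⟨-, hy, -⟩ (rfl : A = B)
    have hxy : x = y := hf.injective <|
      le_antisymm (hf.le_of_isPeak hA hy x hx.1) (hf.le_of_isPeak hA hx y hy.1)
    rw [hxy]

lemma notMem_and_le_of_ncard_peaks_le (h : (peaks K p G f v w).ncard ≤ (facesOff K p w).ncard)
    {a : V × Set V} (ha : a ∈ peaks K p G f v w) : w ∉ a.2 ∧ ∀ y ∈ a.2, f y ≤ f a.1 := by
  have hle := h.trans <| (Set.ncard_le_ncard (facesOff_subset_image_snd p G f v w)).trans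
    (Set.ncard_image_le (Set.toFinite _))
  have heq := Set.eq_of_subset_of_ncard_le (Set.sep_subset _ _) hle
  exact (heq.symm ▸ ha : a ∈ {a ∈ peaks K p G f v w | w ∉ a.2 ∧ ∀ y ∈ a.2, f y ≤ f a.1}).2

end Counting

/-! ### Cones with two non-simple rays -/

/-- Two realizations of the same graph in which all vertices except `v` and `w` are simple. -/
structure AlmostSimplePair (K : Type*) {V W W' : Type*} [Field K] [LinearOrder K] [AddCommGroup W]
    [Module K W] [AddCommGroup W'] [Module K W'] (p : V → W) (q : V → W') (G : SimpleGraph V)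
    (v w : V) : Prop where
  fst : Realizes K p G
  snd : Realizes K q G
  ne : v ≠ w
  isSimple_fst : ∀ x ∉ ({v, w} : Set V), IsSimple K p G x
  isSimple_snd : ∀ x ∉ ({v, w} : Set V), IsSimple K q G x

namespace AlmostSimplePair

variable {K V W W' : Type*} [Field K] [LinearOrder K] [AddCommGroup W] [Module K W]
  [AddCommGroup W'] [Module K W'] {G : SimpleGraph V} {p : V → W} {q : V → W'} {v w x z : V}
  {A B F : Set V}

lemma symm (h : AlmostSimplePair K p q G v w) : AlmostSimplePair K q p G v w :=
  ⟨h.snd, h.fst, h.ne, h.isSimple_snd, h.isSimple_fst⟩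

lemma swap (h : AlmostSimplePair K p q G v w) : AlmostSimplePair K p q G w v :=
  ⟨h.fst, h.snd, h.ne.symm, Set.pair_comm v w ▸ h.isSimple_fst, Set.pair_comm v w ▸ h.isSimple_snd⟩

variable [IsStrictOrderedRing K] [Finite V]

lemma exists_mem_peaks {α : Type*} [LinearOrder α] (h : AlmostSimplePair K p q G v w) {f : V → α}
    (hT : ∀ A, w ∉ A → IsPeak G f A v → IsFace K q A → IsFace K p A)
    (hA : (x, A) ∈ peaks K q G f v w) : ∃ B, (x, B) ∈ peaks K p G f v w ∧ AgreeAt G A B x := by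
  obtain ⟨hA, hx, hxw, hxv⟩ := hA
  by_cases hv : x = v
  · subst hv
    exact ⟨A, ⟨hT A (hxv rfl) hx hA, hx, hxw, hxv⟩, hx.1, hx.1, rfl⟩
  · obtain ⟨B, hB, hAB⟩ := h.fst.exists_isFace_agreeAt (h.isSimple_fst x (by simp [hv, hxw])) hx.1
    exact ⟨B, ⟨hB, hx.of_agreeAt hAB, hxw, fun h => absurd h hv⟩, hAB⟩

lemma ncard_peaks_le {α : Type*} [LinearOrder α] (h : AlmostSimplePair K p q G v w) {f : V → α}
    (hT : ∀ A, w ∉ A → IsPeak G f A v → IsFace K q A → IsFace K p A) :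
    (peaks K q G f v w).ncard ≤ (peaks K p G f v w).ncard := by
  have hex (a : V × Set V) (ha : a ∈ peaks K q G f v w) := h.exists_mem_peaks hT ha
  choose! B hB hAB using hex
  refine Set.ncard_le_ncard_of_injOn (fun a => (a.1, B a)) hB ?_
  rintro ⟨x, A⟩ ha ⟨y, A'⟩ ha' heq
  obtain ⟨rfl, hBB⟩ : x = y ∧ B (x, A) = B (y, A') := Prod.ext_iff.1 heq
  have hAA : AgreeAt G A A' x := ⟨(hAB _ ha).mem_left, (hAB _ ha').mem_left,
    (hAB _ ha).inter_eq.trans (hBB ▸ (hAB _ ha').inter_eq.symm)⟩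
  exact Prod.ext rfl (h.snd.eq_of_agreeAt ha.1 ha'.1 hAA)

lemma isFace_of_isPeak_first {α : Type*} [LinearOrder α] (h : AlmostSimplePair K p q G v w)
    {f : V → α} (hv : ∀ x ≠ v, f v < f x) (hmax : IsPeak G f A v) (hA : IsFace K q A) :
    IsFace K p A := by
  have hsub : A ⊆ {v} := by
    by_contra hsub
    obtain ⟨y, hy, hadj⟩ := h.snd.exists_adj hA hmax.1 (by simpa [Set.not_subset] using hsub)
    exact (hmax.2 y hy hadj).not_gt (hv y hadj.ne')
  exact hsub.antisymm (Set.singleton_subset_iff.2 hmax.1) ▸ h.fst.isFace_singleton v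

lemma ncard_facesOff_le (h : AlmostSimplePair K p q G v w) :
    (facesOff K q w).ncard ≤ (facesOff K p w).ncard := by
  obtain ⟨f, hf, -, hlast, hfirst⟩ := h.fst.exists_isGood (h.fst.isFace_singleton v) v
    (w := w) (by simpa using h.ne.symm)
  calc (facesOff K q w).ncard
      ≤ (peaks K q G f v w).ncard := ncard_facesOff_le_ncard_peaks q G f v w
    _ ≤ (peaks K p G f v w).ncard := h.ncard_peaks_le fun A _ hA =>
        h.isFace_of_isPeak_first (hfirst rfl) hA
    _ ≤ (facesOff K p w).ncard := hf.ncard_peaks_le_ncard_facesOff hlast v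

lemma agreeAt_of_inter_subset (h : AlmostSimplePair K p q G v w) (hA : IsFace K p A)
    (hB : IsFace K q B) (hAB : AgreeAt G A B x) (hx : x ∉ ({v, w} : Set V))
    (hz : z ∉ ({v, w} : Set V)) (hzA : z ∈ A) (hzB : z ∈ B) (hsub : G.neighborSet z ∩ B ⊆ A) :
    AgreeAt G A B z := by
  have hpx := h.fst.ncard_neighborSet_inter (h.isSimple_fst x hx) hA hAB.mem_left
  have hpz := h.fst.ncard_neighborSet_inter (h.isSimple_fst z hz) hA hzA
  have hqx := h.snd.ncard_neighborSet_inter (h.isSimple_snd x hx) hB hAB.mem_right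
  have hqz := h.snd.ncard_neighborSet_inter (h.isSimple_snd z hz) hB hzB
  rw [hAB.inter_eq] at hpx
  exact ⟨hzA, hzB, (Set.eq_of_subset_of_ncard_le (Set.subset_inter Set.inter_subset_left hsub)
    (by omega)).symm⟩

lemma eq_of_agreeAt_of_subset (h : AlmostSimplePair K p q G v w) (hA : IsFace K p A)
    (hB : IsFace K q B) (hBA : B ⊆ A) (hwA : w ∉ A) (hAB : AgreeAt G A B x) (hxv : x ≠ v) :
    A = B := by
  have hne : ∀ z ∈ A, z ≠ v → z ∉ ({v, w} : Set V) := fun z hz hzv => by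
    simp [hzv, ne_of_mem_of_not_mem hz hwA]
  have hagree : ∀ z ∈ B, z ≠ v → AgreeAt G A B z := fun z hz hzv =>
    h.agreeAt_of_inter_subset hA hB hAB (hne x hAB.mem_left hxv) (hne z (hBA hz) hzv) (hBA hz) hz
      (Set.inter_subset_right.trans hBA)
  have hmem : ∀ z ∈ A, z ≠ v → z ∈ B := fun z hz hzv =>
    of_preconnected_induce (C := (· ∈ B))
      (h.fst.preconnected_induce_sdiff_of_isFace hA (h.fst.isFace_singleton v))
      (fun a ha b hb hab haB => ((hagree a haB ha.2).mem_iff hab).1 hb.1)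
      ⟨hAB.mem_left, hxv⟩ hAB.mem_right ⟨hz, hzv⟩
  refine Set.Subset.antisymm (fun z hz => ?_) hBA
  by_cases hzv : z = v
  · subst hzv
    obtain ⟨y, hy, hadj⟩ := h.fst.exists_adj hA hz ⟨x, hAB.mem_left, hxv⟩
    exact ((hagree y (hmem y hy hadj.ne') hadj.ne').mem_iff hadj.symm).1 hz
  · exact hmem z hz hzv

-- The face of `q` that agrees with `F` at the largest vertex `x` of `F` has `x` as its maximum,
-- so it is contained in the initial segment `F`.
lemma isFace_of_isGood {α : Type*} [LinearOrder α] (h : AlmostSimplePair K p q G v w)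
    (hF : IsFace K p F) (hwF : w ∉ F) {f : V → α} (hf : IsGood K p G f)
    (hinit : ∀ x ∈ F, ∀ y ∉ F, f x < f y) (hlast : ∀ x ≠ w, f x < f w)
    (hT : ∀ A, w ∉ A → IsPeak G f A v → IsFace K q A → IsFace K p A)
    (hx : x ∈ F) (hmax : ∀ y ∈ F, f y ≤ f x) (hxv : x ≠ v) : IsFace K q F := by
  have hxw : x ≠ w := ne_of_mem_of_not_mem hx hwF
  obtain ⟨B, hB, hFB⟩ := h.snd.exists_isFace_agreeAt (h.isSimple_snd x (by simp [hxv, hxw])) hx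
  have hpeak : (x, B) ∈ peaks K q G f v w :=
    ⟨hB, IsPeak.of_agreeAt ⟨hx, fun y hy _ => hmax y hy⟩ hFB, hxw, fun hv => absurd hv hxv⟩
  have hcard : (peaks K q G f v w).ncard ≤ (facesOff K q w).ncard :=
    ((h.ncard_peaks_le hT).trans (hf.ncard_peaks_le_ncard_facesOff hlast v)).trans
      h.symm.ncard_facesOff_le
  have hBmax : ∀ y ∈ B, f y ≤ f x := (notMem_and_le_of_ncard_peaks_le hcard hpeak).2
  have hBF : B ⊆ F := fun y hy => by_contra fun hyF => (hBmax y hy).not_gt (hinit x hx y hyF)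
  rwa [h.eq_of_agreeAt_of_subset hF hB hBF hwF hFB hxv]

lemma isFace_of_mem_of_notMem (h : AlmostSimplePair K p q G v w) (hF : IsFace K p F) (hvF : v ∈ F)
    (hwF : w ∉ F) : IsFace K q F := by
  obtain ⟨f, hf, hinit, hlast, hfirst⟩ := h.fst.exists_isGood hF v hwF
  obtain ⟨x, hx, hmax⟩ := Set.exists_max_image F f F.toFinite ⟨v, hvF⟩
  rcases eq_or_ne x v with rfl | hxv
  · exact h.symm.isFace_of_isPeak_first (hfirst hvF) ⟨hx, fun y hy _ => hmax y hy⟩ hF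
  · exact h.isFace_of_isGood hF hwF hf hinit hlast
      (fun A _ hA => h.isFace_of_isPeak_first (hfirst hvF) hA) hx hmax hxv

lemma isFace_of_not_pair_subset (h : AlmostSimplePair K p q G v w) (hF : IsFace K p F)
    (hvw : ¬ {v, w} ⊆ F) : IsFace K q F := by
  by_cases hvF : v ∈ F
  · exact h.isFace_of_mem_of_notMem hF hvF fun hwF => hvw (Set.pair_subset hvF hwF)
  by_cases hwF : w ∈ F
  · exact h.swap.isFace_of_mem_of_notMem hF hwF hvF
  rcases F.eq_empty_or_nonempty with rfl | hne
  · exact h.snd.isFace_empty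
  obtain ⟨f, hf, hinit, hlast, -⟩ := h.fst.exists_isGood hF v hwF
  obtain ⟨x, hx, hmax⟩ := Set.exists_max_image F f F.toFinite hne
  exact h.isFace_of_isGood hF hwF hf hinit hlast
    (fun A hwA hA hqA => h.symm.isFace_of_mem_of_notMem hqA hA.1 hwA) hx hmax
    (ne_of_mem_of_not_mem hx hvF)

lemma agreeAt_of_adj (h : AlmostSimplePair K p q G v w) (hA : IsFace K p A) (hB : IsFace K q B)
    (hvA : v ∈ A) (hAB : AgreeAt G A B x) (hx : x ∉ ({v, w} : Set V))
    (hz : z ∉ ({v, w} : Set V)) (hzA : z ∈ A) (hxz : G.Adj x z) : AgreeAt G A B z := by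
  have hzB : z ∈ B := (hAB.mem_iff hxz).1 hzA
  refine h.agreeAt_of_inter_subset hA hB hAB hx hz hzA hzB fun a ⟨hza, haB⟩ => ?_
  by_contra haA
  obtain ⟨T, hT, hzT, hTz, hTA⟩ := h.fst.exists_isFace_inter_eq_pair (h.isSimple_fst z hz) hA hzA
    hAB.mem_left hxz.symm haA hza
  have hxaT : {x, a} ⊆ T := hTz ▸ Set.inter_subset_right
  have hvT : v ∉ T := fun hvT => by
    have : v = z ∨ v = x := hTA.subset ⟨hvT, hvA⟩
    aesop
  have hTq : IsFace K q T := h.isFace_of_not_pair_subset hT fun hvw => hvT (hvw (by simp))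
  have hTB : T ⊆ B := h.snd.subset_of_adj hTq hB hzT hzB
    (hTz ▸ Set.pair_subset hAB.mem_right haB)
  exact haA <| h.fst.subset_of_adj hT hA (hxaT (by simp)) hAB.mem_left
    (fun y ⟨hxy, hy⟩ => (hAB.mem_iff hxy).2 (hTB hy)) (hxaT (by simp))

lemma subset_of_preconnected (h : AlmostSimplePair K p q G v w) (hA : IsFace K p A)
    (hB : IsFace K q B) (hvwA : {v, w} ⊆ A) (hvwB : {v, w} ⊆ B) (hAB : AgreeAt G A B x)
    (hx : x ∉ ({v, w} : Set V)) (hcon : (G.induce (A \ {v, w})).Preconnected) : A ⊆ B := by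
  intro y hy
  by_cases hyvw : y ∈ ({v, w} : Set V)
  · exact hvwB hyvw
  · refine (of_preconnected_induce (C := AgreeAt G A B) hcon ?_ ⟨hAB.mem_left, hx⟩ hAB
      ⟨hy, hyvw⟩).mem_right
    exact fun a ha b hb hab hagree =>
      h.agreeAt_of_adj hA hB (hvwA (by simp)) hagree ha.2 hb.2 hb.1 hab

lemma exists_isFace_agreeAt (h : AlmostSimplePair K p q G v w) (hF : IsFace K p F)
    (hvw : {v, w} ⊆ F) (hx : x ∉ ({v, w} : Set V)) (hxF : x ∈ F) :
    ∃ B, IsFace K q B ∧ AgreeAt G F B x ∧ {v, w} ⊆ B := by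
  obtain ⟨B, hB, hFB⟩ := h.snd.exists_isFace_agreeAt (h.isSimple_snd x hx) hxF
  refine ⟨B, hB, hFB, by_contra fun hvwB => ?_⟩
  have hBp := h.symm.isFace_of_not_pair_subset hB hvwB
  exact hvwB (h.fst.eq_of_agreeAt hF hBp hFB ▸ hvw)

lemma subset_of_agreeAt (h : AlmostSimplePair K p q G v w) (hA : IsFace K p A) (hB : IsFace K q B)
    (hvwA : {v, w} ⊆ A) (hvwB : {v, w} ⊆ B) (hAB : AgreeAt G A B x)
    (hx : x ∉ ({v, w} : Set V)) : A ⊆ B := by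
  by_cases hadj : G.Adj v w
  · exact h.subset_of_preconnected hA hB hvwA hvwB hAB hx
      (h.fst.preconnected_induce_sdiff_of_isFace hA (h.fst.adj_iff.1 hadj).2)
  rcases le_or_gt (Module.finrank K (Submodule.span K (p '' A))) 3 with hr | hr
  · intro z hz
    by_cases hzvw : z ∈ ({v, w} : Set V)
    · exact hvwB hzvw
    obtain ⟨C, hC, hAC, hvwC⟩ := h.exists_isFace_agreeAt hA hvwA hzvw hz
    have hrC : Module.finrank K (Submodule.span K (q '' C)) ≤ 3 := by
      rwa [← h.snd.ncard_neighborSet_inter (h.isSimple_snd z hzvw) hC hAC.mem_right,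
        ← hAC.inter_eq, h.fst.ncard_neighborSet_inter (h.isSimple_fst z hzvw) hA hz]
    exact h.snd.subset_of_finrank_le_three h.isSimple_snd hC hB hvwC hvwB h.ne hadj hrC
      hAC.mem_right
  · exact h.subset_of_preconnected hA hB hvwA hvwB hAB hx
      (h.fst.preconnected_induce_sdiff hA (by rwa [Set.ncard_pair h.ne]))

lemma isFace_of_isFace (h : AlmostSimplePair K p q G v w) (hF : IsFace K p F) : IsFace K q F := by
  by_cases hvw : {v, w} ⊆ F
  swap
  · exact h.isFace_of_not_pair_subset hF hvw
  by_cases hsub : F ⊆ {v, w}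
  · obtain rfl := hsub.antisymm hvw
    exact (h.snd.adj_iff.1 (h.fst.adj_iff.2 ⟨h.ne, hF⟩)).2
  obtain ⟨x, hxF, hx⟩ := Set.not_subset.1 hsub
  obtain ⟨B, hB, hFB, hvwB⟩ := h.exists_isFace_agreeAt hF hvw hx hxF
  have hFB' : F ⊆ B := h.subset_of_agreeAt hF hB hvw hvwB hFB hx
  have hBF : B ⊆ F := h.symm.subset_of_agreeAt hB hF hvwB hvw hFB.symm hx
  rwa [hFB'.antisymm hBF]

theorem isFace_iff (h : AlmostSimplePair K p q G v w) : IsFace K p F ↔ IsFace K q F :=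
  ⟨h.isFace_of_isFace, h.symm.isFace_of_isFace⟩

end AlmostSimplePair

lemma isFace_comp_iff {K V V' W : Type*} [Field K] [LinearOrder K] [AddCommGroup W] [Module K W]
    {p : V → W} (e : V' ≃ V) {A : Set V'} : IsFace K (p ∘ e) A ↔ IsFace K p (e '' A) := by
  simp [IsFace, e.forall_congr_left, Set.mem_image_equiv]

lemma Realizes.comp {K V V' W : Type*} [Field K] [LinearOrder K] [AddCommGroup W] [Module K W]
    {G : SimpleGraph V} {G' : SimpleGraph V'} {p : V → W} (h : Realizes K p G) (e : G' ≃g G) :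
    Realizes K (p ∘ e.toEquiv) G' where
  isFace_empty := (isFace_comp_iff e.toEquiv).2 (by simpa using h.isFace_empty)
  isFace_singleton i := (isFace_comp_iff e.toEquiv).2 (by simpa using h.isFace_singleton (e i))
  adj_iff {i j} := by
    rw [isFace_comp_iff, ← e.map_adj_iff, h.adj_iff, Set.image_pair]
    simp

lemma exists_ne_subset_pair {α : Type*} [Nontrivial α] {S : Set α} (hS : S.encard ≤ 2) :
    ∃ v w, v ≠ w ∧ S ⊆ {v, w} := by
  have hcard : 2 ≤ (Set.univ : Set α).encard := by
    rw [← one_add_one_eq_two]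
    exact Order.add_one_le_of_lt (Set.one_lt_encard_iff_nontrivial.2 Set.nontrivial_univ)
  obtain ⟨r, hSr, -, hr⟩ := Set.exists_superset_subset_encard_eq (Set.subset_univ S) hS hcard
  obtain ⟨v, w, hvw, rfl⟩ := Set.encard_eq_two.1 hr
  exact ⟨v, w, hvw, hSr⟩

theorem Realizes.isFace_iff {K V W W' : Type*} [Field K] [LinearOrder K] [IsStrictOrderedRing K]
    [Finite V] [AddCommGroup W] [Module K W] [AddCommGroup W'] [Module K W'] {G : SimpleGraph V}
    {p : V → W} {q : V → W'} (hp : Realizes K p G) (hq : Realizes K q G)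
    (hpq : Module.finrank K (Submodule.span K (Set.range p)) =
      Module.finrank K (Submodule.span K (Set.range q)))
    (hS : {x | ¬ IsSimple K q G x}.encard ≤ 2) {A : Set V} : IsFace K p A ↔ IsFace K q A := by
  rcases subsingleton_or_nontrivial V with hV | hV
  · rcases Set.Subsingleton.eq_empty_or_singleton A.subsingleton_of_subsingleton with rfl | ⟨x, rfl⟩
    · exact iff_of_true hp.isFace_empty hq.isFace_empty
    · exact iff_of_true (hp.isFace_singleton x) (hq.isFace_singleton x)
  · obtain ⟨v, w, hvw, hsub⟩ := exists_ne_subset_pair hS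
    have hsimple (x : V) (hx : x ∉ ({v, w} : Set V)) : IsSimple K q G x :=
      by_contra fun h => hx (hsub h)
    exact AlmostSimplePair.isFace_iff
      ⟨hp, hq, hvw, fun x hx => (hsimple x hx).trans hpq.symm, hsimple⟩

/-! ### Homogenization of polytopes -/

section Homogenization

variable {K E : Type*} [Field K] [AddCommGroup E] [Module K E] {s : Set E} {x₀ : E}

lemma span_image_prodMk_one (hx₀ : x₀ ∈ s) :
    Submodule.span K ((fun x => (x, (1 : K))) '' s) =
      (vectorSpan K s).map (LinearMap.inl K E K) ⊔ Submodule.span K {(x₀, 1)} := by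
  rw [vectorSpan_eq_span_vsub_set_right K hx₀, Submodule.map_span, ← Submodule.span_union]
  apply le_antisymm <;> rw [Submodule.span_le]
  · rintro _ ⟨x, hx, rfl⟩
    have hsplit : ((x, 1) : E × K) = LinearMap.inl K E K (x -ᵥ x₀) + (x₀, 1) := by simp
    beta_reduce
    rw [SetLike.mem_coe, hsplit]
    exact Submodule.add_mem _ (Submodule.subset_span (.inl ⟨_, ⟨x, hx, rfl⟩, rfl⟩))
      (Submodule.subset_span (.inr rfl))
  · rintro _ (⟨_, ⟨x, hx, rfl⟩, rfl⟩ | rfl)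
    · have hsplit : LinearMap.inl K E K (x -ᵥ x₀) = (x, 1) - (x₀, 1) := by simp
      rw [SetLike.mem_coe, hsplit]
      exact Submodule.sub_mem _ (Submodule.subset_span ⟨x, hx, rfl⟩)
        (Submodule.subset_span ⟨x₀, hx₀, rfl⟩)
    · exact Submodule.subset_span ⟨x₀, hx₀, rfl⟩

lemma finrank_span_image_prodMk_one [FiniteDimensional K E] (hs : s.Nonempty) :
    Module.finrank K (Submodule.span K ((fun x => (x, (1 : K))) '' s)) =
      Module.finrank K (vectorSpan K s) + 1 := by
  obtain ⟨x₀, hx₀⟩ := hs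
  have hinf : (vectorSpan K s).map (LinearMap.inl K E K) ⊓ Submodule.span K {(x₀, 1)} = ⊥ := by
    rw [eq_bot_iff]
    rintro _ ⟨⟨a, -, rfl⟩, hb⟩
    obtain ⟨c, hc⟩ := Submodule.mem_span_singleton.1 hb
    have hc0 : c = 0 := by simpa using congrArg Prod.snd hc
    rw [← hc, hc0, zero_smul]
    exact Submodule.zero_mem _
  have hsum := Submodule.finrank_sup_add_finrank_inf_eq
    ((vectorSpan K s).map (LinearMap.inl K E K)) (Submodule.span K {(x₀, 1)})
  rwa [hinf, finrank_bot, add_zero, ← span_image_prodMk_one hx₀, finrank_span_singleton (by simp),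
    ← (Submodule.equivMapOfInjective _ LinearMap.inl_injective _).finrank_eq] at hsum

end Homogenization

section Polytope

lemma eq_convexHull_extremePoints {E : Type*} [AddCommGroup E] [Module ℝ E] [TopologicalSpace E]
    [T2Space E] [IsTopologicalAddGroup E] [ContinuousSMul ℝ E] [LocallyConvexSpace ℝ E] {s : Set E}
    (hs : IsCompact s) (hconv : Convex ℝ s) (hfin : (s.extremePoints ℝ).Finite) :
    s = convexHull ℝ (s.extremePoints ℝ) :=
  (closure_convexHull_extremePoints hs hconv).symm.trans (hfin.isClosed_convexHull ℝ).closure_eq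

variable {n : ℕ} {P F : Set (Fin n → ℝ)}

lemma IsPolytope.isCompact (hP : IsPolytope P) : IsCompact P := by
  obtain ⟨s, hs, rfl⟩ := hP
  exact hs.isCompact_convexHull ℝ

lemma IsPolytope.convex (hP : IsPolytope P) : Convex ℝ P := by
  obtain ⟨s, -, rfl⟩ := hP
  exact convex_convexHull ℝ s

lemma IsPolytope.finite_extremePoints (hP : IsPolytope P) : (P.extremePoints ℝ).Finite := by
  obtain ⟨s, hs, rfl⟩ := hP
  exact hs.subset extremePoints_convexHull_subset

lemma IsPolytope.eq_convexHull_inter_extremePoints (hP : IsPolytope P) (hF : IsExposed ℝ P F) :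
    F = convexHull ℝ (F ∩ P.extremePoints ℝ) := by
  rw [← hF.isExtreme.extremePoints_eq]
  refine eq_convexHull_extremePoints (hF.isCompact hP.isCompact) (hF.convex hP.convex) ?_
  exact hP.finite_extremePoints.subset hF.isExtreme.extremePoints_subset_extremePoints

lemma vertices_subset : vertices P ⊆ P := fun _ hx => IsExposed.subset hx rfl

lemma vertices_subset_extremePoints : vertices P ⊆ P.extremePoints ℝ := fun _ hx =>
  isExtreme_singleton.1 (IsExposed.isExtreme hx)

lemma IsPolytope.vertices_eq (hP : IsPolytope P) : vertices P = P.extremePoints ℝ := by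
  refine vertices_subset_extremePoints.antisymm fun x hx => ?_
  have hnot : x ∉ convexHull ℝ (P.extremePoints ℝ \ {x}) := fun hmem =>
    (hP.convex.mem_extremePoints_iff_mem_sdiff_convexHull_sdiff.1 hx).2
      (convexHull_mono (Set.sdiff_subset_sdiff_left extremePoints_subset) hmem)
  obtain ⟨f, u, hfx, hfu⟩ := geometric_hahn_banach_point_closed (convex_convexHull ℝ _)
    ((hP.finite_extremePoints.subset Set.sdiff_subset).isClosed_convexHull ℝ) hnot
  have hF : IsExposed ℝ P ((-f).toExposed P) := ContinuousLinearMap.toExposed.isExposed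
  have hne : ((-f).toExposed P).Nonempty :=
    hP.isCompact.exists_isMaxOn ⟨x, hx.1⟩ (-f).continuous.continuousOn
  have hsub : (-f).toExposed P ∩ P.extremePoints ℝ ⊆ {x} := by
    rintro y ⟨⟨-, hy⟩, hyP⟩
    by_contra hyx
    have hfy : f y ≤ f x := neg_le_neg_iff.1 (hy x hx.1)
    exact hfy.not_gt (hfx.trans (hfu y (subset_convexHull ℝ _ ⟨hyP, hyx⟩)))
  have hFx : (-f).toExposed P = {x} := by
    rw [← hne.subset_singleton_iff, hP.eq_convexHull_inter_extremePoints hF]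
    exact (convexHull_mono hsub).trans (convexHull_singleton x).subset
  rwa [hFx] at hF

lemma IsPolytope.finite_vertices (hP : IsPolytope P) : Finite (vertices P) :=
  (hP.vertices_eq ▸ hP.finite_extremePoints : (vertices P).Finite)

lemma IsPolytope.eq_convexHull_image (hP : IsPolytope P) (hF : IsExposed ℝ P F) :
    F = convexHull ℝ (Subtype.val '' (Subtype.val ⁻¹' F : Set (vertices P))) := by
  rw [Subtype.image_preimage_coe, Set.inter_comm, hP.vertices_eq]
  exact hP.eq_convexHull_inter_extremePoints hF

lemma IsPolytope.eq_convexHull_vertices (hP : IsPolytope P) : P = convexHull ℝ (vertices P) :=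
  hP.vertices_eq ▸ eq_convexHull_extremePoints hP.isCompact hP.convex hP.finite_extremePoints

/-- The vertices of `P`, placed at height one. They span the homogenization cone of `P`. -/
def lift (P : Set (Fin n → ℝ)) (v : vertices P) : (Fin n → ℝ) × ℝ := (v, 1)

lemma isFace_preimage (hF : IsExposed ℝ P F) : IsFace ℝ (lift P) (Subtype.val ⁻¹' F) := by
  rcases F.eq_empty_or_nonempty with rfl | hne
  · exact ⟨LinearMap.snd ℝ _ _, by simp, by simp [lift]⟩
  obtain ⟨l, hl⟩ := hF hne
  obtain ⟨x, hx⟩ := hne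
  have hmax : ∀ y ∈ P, l y ≤ l x := (hl ▸ hx : x ∈ {x ∈ P | ∀ y ∈ P, l y ≤ l x}).2
  have hmem (v : vertices P) : (v : Fin n → ℝ) ∈ F ↔ l v = l x := by
    rw [hl] at hx ⊢
    exact ⟨fun hv => (hmax v hv.1).antisymm (hv.2 x hx.1),
      fun hv => ⟨vertices_subset v.2, fun y hy => hv ▸ hmax y hy⟩⟩
  refine ⟨l x • LinearMap.snd ℝ _ _ - (l : (Fin n → ℝ) →ₗ[ℝ] ℝ) ∘ₗ LinearMap.fst ℝ _ _,
    fun v hv => by simp [lift, (hmem v).1 hv], fun v hv => ?_⟩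
  simpa [lift] using (hmax v (vertices_subset v.2)).lt_of_ne fun h => hv ((hmem v).2 h)

lemma IsPolytope.exists_isExposed (hP : IsPolytope P) {A : Set (vertices P)}
    (hA : IsFace ℝ (lift P) A) : ∃ F, IsExposed ℝ P F ∧ Subtype.val ⁻¹' F = A := by
  obtain ⟨m, hmA, hm⟩ := hA.exists_dual
  let l : (Fin n → ℝ) →L[ℝ] ℝ := -LinearMap.toContinuousLinearMap (m ∘ₗ LinearMap.inl ℝ _ _)
  have hsplit (x : Fin n → ℝ) : m (x, 1) = m (0, 1) - l x := by
    have : ((x, 1) : (Fin n → ℝ) × ℝ) = (0, 1) + (x, 0) := by simp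
    rw [this, map_add]
    simp [l]
  have hle : P ⊆ {x | l x ≤ m (0, 1)} := by
    rw [hP.eq_convexHull_vertices]
    refine convexHull_min (fun x hx => ?_) (convex_halfSpace_le l.toLinearMap.isLinear _)
    have : 0 ≤ m (x, 1) := by
      by_cases hxA : ⟨x, hx⟩ ∈ A
      exacts [((hmA _).2 hxA).ge, (hm _ hxA).le]
    rw [hsplit] at this
    exact sub_nonneg.1 this
  refine ⟨{x ∈ P | l x = m (0, 1)}, ?_, ?_⟩
  · rintro ⟨x₀, hx₀, hlx₀⟩
    refine ⟨l, Set.ext fun x => and_congr_right fun hx => ?_⟩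
    exact ⟨fun h y hy => h ▸ hle hy, fun h => (hle hx).antisymm (hlx₀ ▸ h x₀ hx₀)⟩
  · ext v
    rw [← hmA, lift, hsplit v, sub_eq_zero]
    exact ⟨fun h => h.2.symm, fun h => ⟨vertices_subset v.2, h.symm⟩⟩

/-- A face of a polytope corresponds to the set of vertices that it contains. -/
noncomputable def IsPolytope.faceOrderIso (hP : IsPolytope P) :
    Face P ≃o {A : Set (vertices P) // IsFace ℝ (lift P) A} :=
  OrderIso.ofSurjective (OrderEmbedding.ofMapLEIff
    (fun F : Face P => (⟨Subtype.val ⁻¹' F.1, isFace_preimage F.2⟩ :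
      {A : Set (vertices P) // IsFace ℝ (lift P) A}))
    fun F F' => by
      refine ⟨fun h => ?_, fun h => Set.preimage_mono h⟩
      change F.1 ⊆ F'.1
      rw [hP.eq_convexHull_image F.2, hP.eq_convexHull_image F'.2]
      exact convexHull_mono (Set.image_mono h))
    fun A => by
      obtain ⟨F, hF, hFA⟩ := hP.exists_isExposed A.2
      exact ⟨⟨F, hF⟩, Subtype.ext hFA⟩

lemma preimage_segment (v w : vertices P) :
    Subtype.val ⁻¹' segment ℝ (v : Fin n → ℝ) w = ({v, w} : Set (vertices P)) := by
  ext z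
  simp only [Set.mem_preimage, Set.mem_insert_iff, Set.mem_singleton_iff, Subtype.ext_iff]
  refine ⟨fun hz => ?_, ?_⟩
  · exact ((mem_extremePoints_iff_forall_segment.1 (vertices_subset_extremePoints z.2)).2 v
      (vertices_subset v.2) w (vertices_subset w.2) hz).imp Eq.symm Eq.symm
  · rintro (h | h) <;> rw [h]
    exacts [left_mem_segment ℝ _ _, right_mem_segment ℝ _ _]

lemma eq_of_sameRay {x y z : vertices P} (hy : y ≠ x) (hz : z ≠ x)
    (h : SameRay ℝ (y - x : Fin n → ℝ) (z - x)) : y = z := by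
  have hmem {a b : vertices P} (ha : a ≠ x) (hab : Wbtw ℝ (x : Fin n → ℝ) a b) : a = b := by
    rw [Wbtw, affineSegment_eq_segment, ← Set.mem_preimage, preimage_segment] at hab
    exact hab.resolve_left ha
  exact (wbtw_total_of_sameRay_vsub_left h).elim (hmem hy) fun hzy => (hmem hz hzy).symm

lemma IsPolytope.realizes (hP : IsPolytope P) : Realizes ℝ (lift P) (graph P) where
  isFace_empty := ⟨LinearMap.snd ℝ _ _, by simp, by simp [lift]⟩
  isFace_singleton v := by
    convert isFace_preimage v.2 using 1
    ext u
    exact Subtype.ext_iff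
  adj_iff {v w} := by
    refine and_congr_right fun _ => ⟨fun h => preimage_segment v w ▸ isFace_preimage h, fun h => ?_⟩
    obtain ⟨F, hF, hFA⟩ := hP.exists_isExposed h
    have hFseg := hP.eq_convexHull_image hF
    rw [hFA, Set.image_pair, convexHull_pair] at hFseg
    rwa [← hFseg]

lemma IsPolytope.finrank_span_range_lift (hP : IsPolytope P) {k : ℕ} (hk : HasDim P k) :
    Module.finrank ℝ (Submodule.span ℝ (Set.range (lift P))) = k + 1 := by
  obtain ⟨hne, rfl⟩ := hk
  have hV : (vertices P).Nonempty := by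
    rwa [← convexHull_nonempty_iff (𝕜 := ℝ), ← hP.eq_convexHull_vertices]
  have hspan : vectorSpan ℝ (vertices P) = vectorSpan ℝ P := by
    conv_rhs => rw [hP.eq_convexHull_vertices, ← direction_affineSpan, affineSpan_convexHull,
      direction_affineSpan]
  rw [← hspan, ← finrank_span_image_prodMk_one hV, Set.image_eq_range]
  rfl

theorem combEquiv_of_isFace_iff {m : ℕ} {Q : Set (Fin m → ℝ)} (hP : IsPolytope P)
    (hQ : IsPolytope Q) (e : vertices Q ≃ vertices P)
    (h : ∀ A, IsFace ℝ (lift P ∘ e) A ↔ IsFace ℝ (lift Q) A) : CombEquiv P Q := by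
  let i : {A // IsFace ℝ (lift Q) A} ≃o {A // IsFace ℝ (lift P) A} :=
    { e.toOrderIsoSet.toEquiv.subtypeEquiv fun A => (h A).symm.trans (isFace_comp_iff e) with
      map_rel_iff' := e.toOrderIsoSet.map_rel_iff }
  exact ⟨(hP.faceOrderIso.trans i.symm).trans hQ.faceOrderIso.symm⟩

theorem IsPolytope.reconstructibleFromGraph (hP : IsPolytope P) {k : ℕ} (hk : HasDim P k)
    (hS : {x | ((graph P).neighborSet x).ncard ≠ k}.encard ≤ 2) : ReconstructibleFromGraph P := by
  rintro _ ⟨-, rfl⟩ m R hR hRk ⟨e⟩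
  rw [hk.2] at hRk
  have := hP.finite_vertices
  have hrange : Set.range (lift R ∘ e.symm.toEquiv) = Set.range (lift R) :=
    e.symm.toEquiv.surjective.range_comp _
  refine combEquiv_of_isFace_iff hR hP e.symm.toEquiv fun A =>
    (hR.realizes.comp e.symm).isFace_iff hP.realizes ?_ ?_
  · rw [hrange, hR.finrank_span_range_lift hRk, hP.finrank_span_range_lift hk]
  · simpa [IsSimple, hP.finrank_span_range_lift hk] using hS

end Polytope

/-! ### Slices of the cube -/

section Cube

variable {d : ℕ} {u x y δ : Fin d → ℝ} {t : ℝ} {i j : Fin d}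

lemma cube_eq_Icc : cube d = Set.Icc (-1) 1 := by
  ext x
  simp [cube, Pi.le_def, forall_and]

/-- The intersection of the cube with the hyperplane `⟨u, x⟩ = t`, without a condition on its
dimension. -/
def slice (d : ℕ) (u : Fin d → ℝ) (t : ℝ) : Set (Fin d → ℝ) := cube d ∩ {x | u ⬝ᵥ x = t}

lemma dotProduct_sub_eq_zero (hx : x ∈ slice d u t) (hy : y ∈ slice d u t) :
    u ⬝ᵥ (y - x) = 0 := by
  rw [dotProduct_sub, hx.2, hy.2, sub_self]

lemma mul_sub_nonpos (hy : y ∈ cube d) (hj : |x j| = 1) : x j * (y j - x j) ≤ 0 := by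
  obtain ⟨hy₁, hy₂⟩ := hy j
  rcases eq_or_eq_neg_of_abs_eq hj with h | h <;> rw [h] <;> linarith

open Topology in
lemma eventually_le_add_mul {a b c : ℝ} (hab : a ≤ b) (h : a = b → 0 ≤ c) :
    ∀ᶠ ε in 𝓝[>] 0, a ≤ b + ε * c := by
  rcases hab.eq_or_lt with heq | hlt
  · filter_upwards [self_mem_nhdsWithin] with ε hε
    exact heq.le.trans (le_add_of_nonneg_right (mul_nonneg (le_of_lt hε) (h heq)))
  · have hcont : Continuous fun ε : ℝ => b + ε * c := by fun_prop
    exact nhdsWithin_le_nhds (hcont.continuousAt.eventually_const_le (by simpa using hlt))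

open Topology in
lemma eventually_add_smul_mem_slice (hx : x ∈ slice d u t)
    (hδ : ∀ j, |x j| = 1 → x j * δ j ≤ 0) (hu : u ⬝ᵥ δ = 0) :
    ∀ᶠ ε : ℝ in 𝓝[>] 0, x + ε • δ ∈ slice d u t := by
  have hcube : ∀ᶠ ε : ℝ in 𝓝[>] 0, x + ε • δ ∈ cube d := by
    simp only [cube, Set.mem_ofPred_eq, Filter.eventually_all]
    intro j
    have hlower := eventually_le_add_mul (c := δ j) (hx.1 j).1 fun h => by
      simpa [← h] using hδ j (by simp [← h])
    have hupper := eventually_le_add_mul (c := -δ j) (neg_le_neg (hx.1 j).2) fun h => by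
      simpa [← neg_inj.1 h] using hδ j (by simp [← neg_inj.1 h])
    filter_upwards [hlower, hupper] with ε h₁ h₂
    exact ⟨h₁, by simp only [Pi.add_apply, Pi.smul_apply, smul_eq_mul]; linarith⟩
  filter_upwards [hcube] with ε hε
  exact ⟨hε, by simp [dotProduct_add, hu, show u ⬝ᵥ x = t from hx.2]⟩

-- For small `ε`, the point `x + (ε / 2) • (y - x)` of the segment is the midpoint of the points
-- `x + ε • δ` and `x + ε • (y - x - δ)` of the slice.
lemma exists_eq_smul_of_isExtreme_segment (hseg : IsExtreme ℝ (slice d u t) (segment ℝ x y))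
    (hδ : ∀ j, |x j| = 1 → x j * δ j ≤ 0)
    (hδ' : ∀ j, |x j| = 1 → x j * (y j - x j - δ j) ≤ 0) (hu : u ⬝ᵥ δ = 0) :
    ∃ s : ℝ, δ = s • (y - x) := by
  have hx := hseg.subset (left_mem_segment ℝ x y)
  have hy := hseg.subset (right_mem_segment ℝ x y)
  have hmem := eventually_add_smul_mem_slice hx hδ hu
  have hmem' := eventually_add_smul_mem_slice (δ := y - x - δ) hx hδ'
    (by rw [dotProduct_sub, dotProduct_sub_eq_zero hx hy, hu, sub_zero])
  obtain ⟨ε, ⟨hε, hε'⟩, hε₀, hε₁⟩ :=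
    ((hmem.and hmem').and (Ioo_mem_nhdsGT zero_lt_one)).exists
  have hmid : x + (ε / 2) • (y - x) ∈ segment ℝ x y := by
    rw [segment_eq_image']
    exact ⟨ε / 2, ⟨by linarith, by linarith⟩, rfl⟩
  have hopen : x + (ε / 2) • (y - x) ∈ openSegment ℝ (x + ε • δ) (x + ε • (y - x - δ)) :=
    ⟨1 / 2, 1 / 2, by norm_num, by norm_num, by norm_num, by module⟩
  have hleft := hseg.left_mem_of_mem_openSegment hε hε' hmid hopen
  rw [segment_eq_image'] at hleft
  obtain ⟨s, -, hs⟩ := hleft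
  exact ⟨ε⁻¹ * s, by rw [mul_smul, add_left_cancel hs, inv_smul_smul₀ hε₀.ne']⟩

lemma eq_zero_of_mem_extremePoints (hx : x ∈ (slice d u t).extremePoints ℝ)
    (hδ : ∀ j, |x j| = 1 → δ j = 0) (hu : u ⬝ᵥ δ = 0) : δ = 0 := by
  obtain ⟨s, hs⟩ := exists_eq_smul_of_isExtreme_segment (y := x) (δ := δ)
    (by rwa [segment_same, isExtreme_singleton]) (fun j hj => by simp [hδ j hj])
    (fun j hj => by simp [hδ j hj]) hu
  simpa using hs

lemma ne_zero_of_abs_ne_one (hx : x ∈ (slice d u t).extremePoints ℝ) (hi : |x i| ≠ 1) :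
    u i ≠ 0 := fun hui => by
  have hzero : (Pi.single i 1 : Fin d → ℝ) = 0 := eq_zero_of_mem_extremePoints hx
    (fun j hj => Pi.single_eq_of_ne (ne_of_apply_ne (|x ·|) (hj.trans_ne hi.symm)) _)
    (by simp [hui])
  simpa using congrFun hzero i

lemma abs_eq_one_of_ne (hx : x ∈ (slice d u t).extremePoints ℝ) (hi : |x i| ≠ 1)
    (hji : j ≠ i) : |x j| = 1 := by
  by_contra hj
  have hzero : (Pi.single i (u j) - Pi.single j (u i) : Fin d → ℝ) = 0 :=
    eq_zero_of_mem_extremePoints hx (fun l hl => by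
      have hli : l ≠ i := ne_of_apply_ne (|x ·|) (hl.trans_ne (Ne.symm hi))
      have hlj : l ≠ j := ne_of_apply_ne (|x ·|) (hl.trans_ne (Ne.symm hj))
      simp [hli, hlj]) (by simp [dotProduct_sub, mul_comm])
  exact ne_zero_of_abs_ne_one hx hi (by simpa [hji] using congrFun hzero j)

lemma finite_extremePoints_slice : ((slice d u t).extremePoints ℝ).Finite := by
  refine Set.Finite.of_injOn (f := fun x => ({j | x j = 1}, {j | x j = -1}))
    (Set.mapsTo_univ _ _) (fun x hx y hy hxy => ?_) Set.finite_univ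
  obtain ⟨hpos, hneg⟩ := Prod.ext_iff.1 hxy
  refine (sub_eq_zero.1 (eq_zero_of_mem_extremePoints hx (fun j hj => ?_)
    (dotProduct_sub_eq_zero hx.1 hy.1))).symm
  rcases eq_or_eq_neg_of_abs_eq hj with h | h
  · rw [Pi.sub_apply, h, (Set.ext_iff.1 hpos j).1 h, sub_self]
  · rw [Pi.sub_apply, h, (Set.ext_iff.1 hneg j).1 h, sub_self]

lemma isPolytope_slice (d : ℕ) (u : Fin d → ℝ) (t : ℝ) : IsPolytope (slice d u t) := by
  have hclosed : IsClosed {x : Fin d → ℝ | u ⬝ᵥ x = t} :=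
    isClosed_eq (by fun_prop) continuous_const
  have hconv : Convex ℝ {x : Fin d → ℝ | u ⬝ᵥ x = t} :=
    convex_hyperplane ⟨dotProduct_add u, fun c x => dotProduct_smul c u x⟩ t
  refine ⟨_, finite_extremePoints_slice,
    eq_convexHull_extremePoints ?_ ?_ finite_extremePoints_slice⟩
  · exact (cube_eq_Icc ▸ isCompact_Icc).inter_right hclosed
  · exact (cube_eq_Icc ▸ convex_Icc _ _).inter hconv

lemma mem_vertices_cube (hx : ∀ i, |x i| = 1) : x ∈ vertices (cube d) := by
  intro _
  have hxcube : x ∈ cube d := fun i => abs_le.1 (hx i).le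
  have hle (y) (hy : y ∈ cube d) (i) : x i * y i ≤ x i * x i := by
    simpa [mul_sub] using mul_sub_nonpos hy (hx i)
  refine ⟨LinearMap.toContinuousLinearMap (dotProductBilin ℝ ℝ x), ?_⟩
  ext y
  simp only [Set.mem_singleton_iff, Set.mem_ofPred_eq, LinearMap.coe_toContinuousLinearMap',
    dotProductBilin_apply_apply]
  constructor
  · rintro rfl
    exact ⟨hxcube, fun z hz => Finset.sum_le_sum fun i _ => hle z hz i⟩
  · rintro ⟨hy, hmax⟩
    have heq := (Finset.sum_eq_sum_iff_of_le fun i _ => hle y hy i).1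
      ((Finset.sum_le_sum fun i _ => hle y hy i).antisymm (hmax x hxcube))
    exact funext fun i => mul_left_cancel₀ (abs_ne_zero.1 (by simp [hx i]))
      (heq i (Finset.mem_univ i))

/-- Let `x` be a point of the slice in the relative interior of an edge of the cube parallel to
the `i`-th axis. This is the direction in the hyperplane that leaves, towards the interior of the
cube, the facet of the cube fixing the `j`-th coordinate, but no other facet through `x`. -/
noncomputable def inwardDir (u x : Fin d → ℝ) (i j : Fin d) : Fin d → ℝ :=
  x j • (Pi.single i (u j / u i) - Pi.single j 1)

lemma inwardDir_apply_self (hji : j ≠ i) : inwardDir u x i j j = -x j := by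
  simp [inwardDir, hji]

lemma inwardDir_apply_of_ne {l : Fin d} (hli : l ≠ i) (hlj : l ≠ j) : inwardDir u x i j l = 0 := by
  simp [inwardDir, hli, hlj]

lemma dotProduct_inwardDir (hu : u i ≠ 0) : u ⬝ᵥ inwardDir u x i j = 0 := by
  simp [inwardDir, dotProduct_sub, mul_div_cancel₀ _ hu]

lemma exists_sameRay_inwardDir (hx : x ∈ (slice d u t).extremePoints ℝ) (hi : |x i| ≠ 1)
    (hyx : y ≠ x) (hseg : IsExtreme ℝ (slice d u t) (segment ℝ x y)) :
    ∃ j ≠ i, SameRay ℝ (y - x) (inwardDir u x i j) := by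
  have hy := hseg.subset (right_mem_segment ℝ x y)
  have hne (j) (hj : |x j| = 1) : j ≠ i := ne_of_apply_ne (|x ·|) (hj.trans_ne hi.symm)
  obtain ⟨j, hj, hyj⟩ : ∃ j, |x j| = 1 ∧ (y - x) j ≠ 0 := by
    by_contra! hcon
    exact hyx (sub_eq_zero.1 (eq_zero_of_mem_extremePoints hx hcon
      (dotProduct_sub_eq_zero hx.1 hy)))
  have hc : 0 ≤ -(x j * (y j - x j)) := neg_nonneg.2 (mul_sub_nonpos hy.1 hj)
  have hδj : (-(x j * (y j - x j)) • inwardDir u x i j) j = y j - x j := by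
    have hsq : x j * x j = 1 := by rw [← abs_mul_abs_self, hj, one_mul]
    rw [Pi.smul_apply, inwardDir_apply_self (hne j hj), smul_eq_mul]
    linear_combination (y j - x j) * hsq
  have hδl (l) (hl : |x l| = 1) (hlj : l ≠ j) :
      (-(x j * (y j - x j)) • inwardDir u x i j) l = 0 := by
    rw [Pi.smul_apply, inwardDir_apply_of_ne (hne l hl) hlj, smul_zero]
  obtain ⟨s, hs⟩ := exists_eq_smul_of_isExtreme_segment hseg
    (δ := -(x j * (y j - x j)) • inwardDir u x i j)
    (fun l hl => by
      rcases eq_or_ne l j with rfl | hlj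
      · rw [hδj]; exact mul_sub_nonpos hy.1 hl
      · rw [hδl l hl hlj, mul_zero])
    (fun l hl => by
      rcases eq_or_ne l j with rfl | hlj
      · rw [hδj, sub_self, mul_zero]
      · rw [hδl l hl hlj, sub_zero]; exact mul_sub_nonpos hy.1 hl)
    (by rw [dotProduct_smul, dotProduct_inwardDir (ne_zero_of_abs_ne_one hx hi), smul_zero])
  have hs1 : s = 1 := by
    rw [hs] at hδj
    exact mul_right_cancel₀ hyj (hδj.trans (one_mul _).symm)
  rw [hs1, one_smul] at hs
  exact ⟨j, hne j hj, hs ▸ SameRay.sameRay_nonneg_smul_left _ hc⟩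

lemma ncard_neighborSet_le (x : vertices (slice d u t)) (hi : |x.1 i| ≠ 1) :
    ((graph (slice d u t)).neighborSet x).ncard ≤ d - 1 := by
  have hx := vertices_subset_extremePoints x.2
  have : Nonempty (Fin d) := ⟨i⟩
  choose! J hJi hJ using fun y (hy : (graph (slice d u t)).Adj x y) =>
    exists_sameRay_inwardDir hx hi (Subtype.coe_injective.ne hy.ne') hy.2.isExtreme
  have hcard : ({i}ᶜ : Set (Fin d)).ncard = d - 1 := by
    rw [Set.ncard_compl, Set.ncard_singleton, Nat.card_fin]
  rw [← hcard]
  refine Set.ncard_le_ncard_of_injOn J hJi fun y hy z hz hyz => ?_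
  refine eq_of_sameRay (Ne.symm hy.1) (Ne.symm hz.1) ((hJ y hy).trans (hyz ▸ (hJ z hz).symm) ?_)
  intro hzero
  have hxJ := abs_eq_one_of_ne hx hi (hJi y hy)
  have := congrFun hzero (J y)
  rw [inwardDir_apply_self (hJi y hy), Pi.zero_apply, neg_eq_zero] at this
  simp [this] at hxJ

lemma ncard_neighborSet_of_notMem_vertices_cube (hdim : HasDim (slice d u t) (d - 1))
    (x : vertices (slice d u t)) (hx : x.1 ∉ vertices (cube d)) :
    ((graph (slice d u t)).neighborSet x).ncard = d - 1 := by
  obtain ⟨i, hi⟩ : ∃ i, |x.1 i| ≠ 1 := by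
    by_contra! hall
    exact hx (mem_vertices_cube hall)
  have hP := isPolytope_slice d u t
  have := hP.finite_vertices
  refine (ncard_neighborSet_le x hi).antisymm (Nat.le_of_add_le_add_right (b := 1) ?_)
  exact hP.finrank_span_range_lift hdim ▸ hP.realizes.finrank_span_le_ncard_neighborSet_add_one x

end Cube

end CubeSlice

theorem proposition4p1 (d : ℕ) (Q : Set (Fin d → ℝ)) (hQ : CubeSlice.IsSlice d Q)
    (hvert : (Q ∩ CubeSlice.vertices (CubeSlice.cube d)).encard ≤ 2) :
    CubeSlice.ReconstructibleFromGraph Q := by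
  obtain ⟨u, t, -, rfl, hdim⟩ := hQ
  refine (CubeSlice.isPolytope_slice d u t).reconstructibleFromGraph hdim ?_
  rw [← Subtype.val_injective.encard_image]
  refine (Set.encard_le_encard ?_).trans hvert
  rintro _ ⟨x, hx, rfl⟩
  exact ⟨CubeSlice.vertices_subset x.2, not_imp_comm.1
    (CubeSlice.ncard_neighborSet_of_notMem_vertices_cube hdim x) hx⟩
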